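/- All graphs are finite, simple, undirected and have at least one vertex. **Twin-width.** A *trigraph* is a graph whose edge set is partitioned into black and red edges; a graph is regarded as a trigraph with only black edges. A $d$-trigraph is a trigraph in which every vertex has at most $d$ red neighbors. Let $N(v)$ be the set of vertices joined to $v$ by a black or red edge. A *contraction* merges two distinct (not necessarily adjacent) vertices $u,v$ into one vertex $w$: a vertex $x\neq u,v$ becomes a red neighbor of $w$ if $x\in N(u)\mathop{\triangle}N(v)$; if $x\in N(u)\cap N(v)$, it becomes a black neighbor of $w$ when it is a black neighbor of both $u$ and $v$, and a red neighbor of $w$ otherwise; $w$ has no other neighbors, and all edges not incident with $u$ or $v$ remain unchanged. The twin-width $\mathrm{tww}(G)$ is the smallest integer $d\ge 0$ such that there is a sequence of $d$-trigraphs that starts with $G$, ends with a trigraph on a single vertex, and in which each member after the first is obtained from its predecessor by a contraction. **Modules.** A *module* of $G$ is a nonempty set $M\subseteq V(G)$ such that for all $x,y\in M$ and $z\in V(G)\setminus M$ we have $xz\in E(G)$ if and only if $yz\in E(G)$. It is *trivial* if $M=V(G)$ or $|M|=1$. A *maximal module* is a module that is not strictly contained in any nontrivial module and that is different from $V(G)$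 unless $|V(G)|=1$. If $G$ and its complement $\overline G$ are connected, the maximal modules form a partition $P_{\max}$ of $V(G)$; the quotient graph $G/P_{\max}$ has the maximal modules as its vertices, and two distinct ones $M_i,M_j$ are adjacent if and only if all pairs $x_i\in M_i$, $x_j\in M_j$ are adjacent in $G$. **The set $\mathrm{prime}(G)$** is defined recursively: 1. If $G$ is disconnected, $\mathrm{prime}(G)$ is the union of the sets $\mathrm{prime}(C)$ over all connected components $C$ of $G$. 2. If $\overline G$ is disconnected, $\mathrm{prime}(G)$ is the union of the sets $\mathrm{prime}(\overline C)$ over all connected components $C$ of $\overline G$. 3. If both $G$ and $\overline G$ are connected, $\mathrm{prime}(G)$ is the union of $\{G/P_{\max}\}$ and the sets $\mathrm{prime}(G[M])$ over all nontrivial $M\in P_{\max}$. **Theorem.** For every graph $G$, $$\mathrm{tww}(G)=\max_{P\in \mathrm{prime}(G)}\mathrm{tww}(P).$$ -/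

import Mathlib

universe u

namespace TwinWidth

/-! ### Trigraphs, contractions and twin-width -/

/-- A trigraph on the vertex set `V`: an undirected graph whose edge set is partitioned into
black edges and red edges. -/
structure Trigraph (V : Type u) where
  /-- the black edges -/
  black : SimpleGraph V
  /-- the red edges -/
  red : SimpleGraph V
  /-- no edge is both black and red -/
  disjoint : Disjoint black red

/-- An ordinary graph is a trigraph all of whose edges are black. -/
def ofGraph {V : Type u} (G : SimpleGraph V) : Trigraph V where
  black := G
  red := ⊥
  disjoint := disjoint_bot_right

namespace Trigraph

/-- The neighbors of `v`: the vertices adjacent to `v` by a black or a red edge. -/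
def neighbors {V : Type u} (G : Trigraph V) (v : V) : Set V :=
  {x | G.black.Adj v x ∨ G.red.Adj v x}

/-- The red degree of a vertex: the number of its red neighbors. -/
noncomputable def redDegree {V : Type u} (G : Trigraph V) (v : V) : ℕ∞ :=
  {x | G.red.Adj v x}.encard

/-- A `d`-trigraph: every vertex has red degree at most `d`. -/
def IsDTrigraph {V : Type u} (d : ℕ) (G : Trigraph V) : Prop :=
  ∀ v, G.redDegree v ≤ d

/-- `G'` is obtained from `G` by a contraction: two distinct vertices `u`, `v` of `G` are merged
into a single vertex `w = f u = f v`, where `f : V → W` is the map that identifies `u` with `v`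
and nothing else. Edges not incident with `u` or `v` are unchanged; a vertex `x ≠ u, v` is
joined to `w` by a red edge if it is a neighbor of exactly one of `u` and `v`; if it is a neighbor
of both, it is joined to `w` by a black edge when it is a black neighbor of both, and by a red edge
otherwise. There are no other edges at `w`. -/
def IsContraction {V W : Type u} (G : Trigraph V) (G' : Trigraph W) : Prop :=
  ∃ (u v : V) (f : V → W), u ≠ v ∧ Function.Surjective f ∧
    (∀ x y, f x = f y ↔ x = y ∨ (x = u ∧ y = v) ∨ (x = v ∧ y = u)) ∧
    (∀ x y, x ≠ u → x ≠ v → y ≠ u → y ≠ v →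
      (G'.black.Adj (f x) (f y) ↔ G.black.Adj x y) ∧
      (G'.red.Adj (f x) (f y) ↔ G.red.Adj x y)) ∧
    (∀ x, x ≠ u → x ≠ v →
      (G'.black.Adj (f u) (f x) ↔
        x ∈ G.neighbors u ∩ G.neighbors v ∧ G.black.Adj u x ∧ G.black.Adj v x) ∧
      (G'.red.Adj (f u) (f x) ↔
        x ∈ symmDiff (G.neighbors u) (G.neighbors v) ∨
        (x ∈ G.neighbors u ∩ G.neighbors v ∧ ¬ (G.black.Adj u x ∧ G.black.Adj v x))))

/-- `HasDSequence d G`: there is a sequence of `d`-trigraphs that starts with `G`, ends with a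
trigraph on a single vertex, and in which every member but the first is obtained from its
predecessor by a contraction. -/
inductive HasDSequence (d : ℕ) : {V : Type u} → Trigraph V → Prop
  | single {V : Type u} (G : Trigraph V) (hV : Nat.card V = 1) (hd : G.IsDTrigraph d) :
      HasDSequence d G
  | contract {V W : Type u} (G : Trigraph V) (G' : Trigraph W) (hd : G.IsDTrigraph d)
      (hc : G.IsContraction G') (hs : HasDSequence d G') : HasDSequence d G

/-- The twin-width of a trigraph: the smallest `d` such that it has a `d`-sequence. -/
noncomputable def tww {V : Type u} (G : Trigraph V) : ℕ :=
  sInf {d | HasDSequence d G}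

end Trigraph

/-- The twin-width of a graph. -/
noncomputable def tww {V : Type u} (G : SimpleGraph V) : ℕ :=
  (ofGraph G).tww

/-! ### Modules, the quotient by the maximal modules, and the set `prime(G)` -/

/-- A module: a nonempty set `M` of vertices such that every vertex outside `M` is adjacent to
all vertices of `M` or to none. -/
def IsModule {V : Type u} (G : SimpleGraph V) (M : Set V) : Prop :=
  M.Nonempty ∧ ∀ x ∈ M, ∀ y ∈ M, ∀ z ∉ M, (G.Adj x z ↔ G.Adj y z)

/-- A vertex set is trivial (as a module) if it is the whole vertex set or has one element. -/
def IsTrivial {V : Type u} (M : Set V) : Prop :=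
  M = Set.univ ∨ M.encard = 1

/-- A maximal module: a module that is not strictly contained in any nontrivial module, where the
whole vertex set is only admitted if it consists of a single vertex. -/
def IsMaximalModule {V : Type u} (G : SimpleGraph V) (M : Set V) : Prop :=
  IsModule G M ∧ (M = Set.univ → M.encard = 1) ∧
    ∀ N, IsModule G N → ¬ IsTrivial N → ¬ M ⊂ N

/-- The set `P_max` of all maximal modules of `G`. It is a partition of the vertex set if `G` and
its complement are connected, which is the only case where it is used. -/
def pMax {V : Type u} (G : SimpleGraph V) : Set (Set V) :=
  {M | IsMaximalModule G M}

/-- The quotient graph `G / P_max`: its vertices are the maximal modules, and two distinct ones are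
joined if and only if all pairs of vertices from the two are joined in `G`. -/
def quotientGraph {V : Type u} (G : SimpleGraph V) : SimpleGraph (pMax G) where
  Adj M N := M ≠ N ∧ ∀ x ∈ M.1, ∀ y ∈ N.1, G.Adj x y
  symm := ⟨fun _ _ h => ⟨h.1.symm, fun x hx y hy => (h.2 y hy x hx).symm⟩⟩
  loopless := ⟨fun _ h => h.1 rfl⟩

/-- `MemPrime G H` says that the graph `H` (bundled with its vertex set) belongs to `prime(G)`. -/
inductive MemPrime : {V : Type u} → SimpleGraph V → (Σ W : Type u, SimpleGraph W) → Prop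
  | component {V : Type u} {G : SimpleGraph V} {H : Σ W : Type u, SimpleGraph W}
      (hG : ¬ G.Connected) (C : G.ConnectedComponent)
      (h : MemPrime C.toSimpleGraph H) : MemPrime G H
  | coComponent {V : Type u} {G : SimpleGraph V} {H : Σ W : Type u, SimpleGraph W}
      (hG : ¬ Gᶜ.Connected) (C : Gᶜ.ConnectedComponent)
      (h : MemPrime (C.toSimpleGraph)ᶜ H) : MemPrime G H
  | quotient {V : Type u} {G : SimpleGraph V} (hG : G.Connected) (hGc : Gᶜ.Connected) :
      MemPrime G ⟨pMax G, quotientGraph G⟩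
  | maximalModule {V : Type u} {G : SimpleGraph V} {H : Σ W : Type u, SimpleGraph W}
      (hG : G.Connected) (hGc : Gᶜ.Connected) (M : Set V) (hM : M ∈ pMax G)
      (hMt : ¬ IsTrivial M) (h : MemPrime (G.induce M) H) : MemPrime G H

/-- The set `prime(G)`. -/
def prime {V : Type u} (G : SimpleGraph V) : Set (Σ W : Type u, SimpleGraph W) :=
  {H | MemPrime G H}

end TwinWidth

/-! Lower bound: every member of prime(G) is an induced subgraph of G (for a quotient, pick one
vertex in each maximal module), and twin-width is monotone under induced subgraphs
(`HasDSequence.of_coarsens`). Upper bound: if the vertex set is partitioned into modules, contract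
inside the modules. This creates no red edge leaving a module, so red degrees are those in the
sequences of the modules. Once each module is a single vertex, an induced subgraph of the quotient
remains, and its sequence finishes the job (`HasDSequence.of_fibres`). Along the recursion for
prime(G) the quotient is edgeless, complete or G/P_max; the first two never need a red edge
(`prime_spec`). Sequences are compared through `Coarsens`, which composes, holds for contractions,
and allows both dropping vertices and turning black edges or non-edges red. -/

namespace TwinWidth

/-! ### Coarsening maps and contractions -/

namespace Trigraph

variable {U V W : Type u}

theorem red_not_black (T : Trigraph V) {x y : V} (h : T.red.Adj x y) : ¬ T.black.Adj x y :=
  fun hb => (SimpleGraph.disjoint_left.1 T.disjoint) x y hb h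

/-- A map `f` coarsens `T` to `G` if, for vertices with distinct images, black edges of `G` come
from black edges of `T`, and edges of `T` are sent to edges of `G`. -/
structure Coarsens (T : Trigraph V) (G : Trigraph W) (f : V → W) : Prop where
  black : ∀ {x y}, f x ≠ f y → G.black.Adj (f x) (f y) → T.black.Adj x y
  adj : ∀ {x y}, f x ≠ f y → T.black.Adj x y ∨ T.red.Adj x y →
    G.black.Adj (f x) (f y) ∨ G.red.Adj (f x) (f y)

theorem Coarsens.comp {T : Trigraph U} {G : Trigraph V} {G' : Trigraph W} {f : U → V} {g : V → W}
    (hg : G.Coarsens G' g) (hf : T.Coarsens G f) : T.Coarsens G' (g ∘ f) where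
  black h hb := hf.black (fun e => h (congrArg g e)) (hg.black h hb)
  adj h ha := hg.adj h (hf.adj (fun e => h (congrArg g e)) ha)

theorem Coarsens.red {T : Trigraph V} {G : Trigraph W} {f : V → W} (h : T.Coarsens G f) {x y : V}
    (hxy : f x ≠ f y) (hr : T.red.Adj x y) : G.red.Adj (f x) (f y) :=
  (h.adj hxy (Or.inr hr)).resolve_left fun hb => T.red_not_black hr (h.black hxy hb)

theorem Coarsens.isDTrigraph {T : Trigraph V} {G : Trigraph W} {f : V → W} (h : T.Coarsens G f)
    (hf : Function.Injective f) {d : ℕ} (hG : G.IsDTrigraph d) : T.IsDTrigraph d := by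
  intro v
  refine le_trans ?_ (hG (f v))
  rw [redDegree, ← hf.encard_image]
  apply Set.encard_le_encard
  rintro _ ⟨x, hx, rfl⟩
  exact h.red (hf.ne hx.ne) hx

/-- The finest trigraph to which `f` coarsens `T`. -/
def map (T : Trigraph V) (f : V → W) : Trigraph W where
  black :=
    { Adj := fun a b => a ≠ b ∧ ∀ x y, f x = a → f y = b → T.black.Adj x y
      symm := ⟨fun _ _ h => ⟨h.1.symm, fun x y hx hy => (h.2 y x hy hx).symm⟩⟩
      loopless := ⟨fun _ h => h.1 rfl⟩ }
  red :=
    { Adj := fun a b => a ≠ b ∧ (∃ x y, f x = a ∧ f y = b ∧ (T.black.Adj x y ∨ T.red.Adj x y)) ∧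
        ∃ x y, f x = a ∧ f y = b ∧ ¬ T.black.Adj x y
      symm := ⟨fun _ _ ⟨h, ⟨x, y, hx, hy, hxy⟩, ⟨x', y', hx', hy', hxy'⟩⟩ =>
        ⟨h.symm, ⟨y, x, hy, hx, hxy.imp (fun h => h.symm) (fun h => h.symm)⟩,
          ⟨y', x', hy', hx', fun h => hxy' h.symm⟩⟩⟩
      loopless := ⟨fun _ h => h.1 rfl⟩ }
  disjoint := by
    rw [SimpleGraph.disjoint_left]
    rintro a b hb ⟨-, -, x, y, hx, hy, hxy⟩
    exact hxy (hb.2 x y hx hy)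

/-- Surjectivity is essential: black adjacency in `T.map f` holds vacuously at a vertex with empty
fibre. -/
theorem map_adj_of {T : Trigraph V} {f : V → W} {a b : W}
    (h : (T.map f).black.Adj a b ∨ (T.map f).red.Adj a b) (hf : Function.Surjective f) :
    ∃ x y, f x = a ∧ f y = b ∧ (T.black.Adj x y ∨ T.red.Adj x y) := by
  rcases h with h | h
  · obtain ⟨x, rfl⟩ := hf a
    obtain ⟨y, rfl⟩ := hf b
    exact ⟨x, y, rfl, rfl, Or.inl (h.2 x y rfl rfl)⟩
  · exact h.2.1

theorem coarsens_map (T : Trigraph V) (f : V → W) : T.Coarsens (T.map f) f where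
  black _ h := h.2 _ _ rfl rfl
  adj {x y} hxy h := by
    by_cases hb : ∀ x' y', f x' = f x → f y' = f y → T.black.Adj x' y'
    · exact Or.inl ⟨hxy, hb⟩
    · push Not at hb
      exact Or.inr ⟨hxy, ⟨x, y, rfl, rfl, h⟩, hb⟩

/-- Universal property of `map`: it records exactly what is forced on the images. -/
theorem Coarsens.of_comp {T : Trigraph U} {f : U → V} {g : V → W} {G : Trigraph W}
    (hf : Function.Surjective f) (h : T.Coarsens G (g ∘ f)) : (T.map f).Coarsens G g where
  black {a b} hab hb := by
    refine ⟨fun e => hab (congrArg g e), ?_⟩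
    rintro x y rfl rfl
    exact h.black hab hb
  adj {a b} hab ha := by
    obtain ⟨x, y, rfl, rfl, hxy⟩ := map_adj_of ha hf
    exact h.adj hab hxy

/-- The only fibre with two elements is `{u, v}`, and there the quantifiers in `map` reduce to the
contraction rule: black if both edges are black, red if there is some edge but not two black ones.
-/
theorem isContraction_map (T : Trigraph V) {f : V → W} {u v : V} (huv : u ≠ v)
    (hf : Function.Surjective f)
    (hf' : ∀ x y, f x = f y ↔ x = y ∨ (x = u ∧ y = v) ∨ (x = v ∧ y = u)) :
    T.IsContraction (T.map f) := by
  have key : ∀ x, x ≠ u → x ≠ v → ∀ y, f y = f x → y = x := by grind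
  have key' : ∀ y, f y = f u → y = u ∨ y = v := by grind
  have hne : ∀ x, x ≠ u → x ≠ v → f u ≠ f x := by grind
  have huv' : f v = f u := by grind
  refine ⟨u, v, f, huv, hf, hf', ?_, ?_⟩
  · intro x y hxu hxv hyu hyv
    by_cases hxy : x = y
    · subst hxy
      simp
    have hfxy : f x ≠ f y := by grind
    constructor
    · constructor
      · exact fun h => h.2 x y rfl rfl
      · refine fun h => ⟨hfxy, fun x' y' hx' hy' => ?_⟩
        rw [key x hxu hxv x' hx', key y hyu hyv y' hy']
        exact h
    · constructor
      · rintro ⟨-, ⟨a, b, ha, hb, hab⟩, c, e, hc, he, hce⟩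
        rw [key x hxu hxv a ha, key y hyu hyv b hb] at hab
        rw [key x hxu hxv c hc, key y hyu hyv e he] at hce
        exact hab.resolve_left hce
      · exact fun h => ⟨hfxy, ⟨x, y, rfl, rfl, Or.inr h⟩, x, y, rfl, rfl, T.red_not_black h⟩
  · intro x hxu hxv
    have hb : (T.map f).black.Adj (f u) (f x) ↔ T.black.Adj u x ∧ T.black.Adj v x := by
      constructor
      · exact fun h => ⟨h.2 u x rfl rfl, h.2 v x huv' rfl⟩
      · refine fun h => ⟨hne x hxu hxv, fun a b ha hb => ?_⟩
        rw [key x hxu hxv b hb]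
        rcases key' a ha with rfl | rfl
        exacts [h.1, h.2]
    have hr : (T.map f).red.Adj (f u) (f x) ↔
        (x ∈ T.neighbors u ∨ x ∈ T.neighbors v) ∧ ¬ (T.black.Adj u x ∧ T.black.Adj v x) := by
      rw [← hb]
      constructor
      · refine fun h => ⟨?_, (T.map f).red_not_black h⟩
        obtain ⟨a, b, ha, hb, hab⟩ := h.2.1
        rw [key x hxu hxv b hb] at hab
        rcases key' a ha with rfl | rfl
        exacts [Or.inl hab, Or.inr hab]
      · rintro ⟨h, h'⟩
        refine Or.resolve_left ?_ h'
        rcases h with h | h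
        · exact (T.coarsens_map f).adj (hne x hxu hxv) h
        · rw [← huv']
          exact (T.coarsens_map f).adj (huv' ▸ hne x hxu hxv) h
    rw [hb, hr, Set.mem_symmDiff]
    simp only [neighbors, Set.mem_inter_iff, Set.mem_ofPred_eq]
    clear hb hr key key' hne huv' hf hf'
    grind

theorem coarsens_of_contraction {G : Trigraph V} {G' : Trigraph W} {u v : V} {f : V → W}
    (hf : ∀ x y, f x = f y ↔ x = y ∨ (x = u ∧ y = v) ∨ (x = v ∧ y = u))
    (h : ∀ x y, x ≠ u → x ≠ v → y ≠ u → y ≠ v →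
      (G'.black.Adj (f x) (f y) ↔ G.black.Adj x y) ∧
      (G'.red.Adj (f x) (f y) ↔ G.red.Adj x y))
    (h' : ∀ x, x ≠ u → x ≠ v →
      (G'.black.Adj (f u) (f x) ↔
        x ∈ G.neighbors u ∩ G.neighbors v ∧ G.black.Adj u x ∧ G.black.Adj v x) ∧
      (G'.red.Adj (f u) (f x) ↔
        x ∈ symmDiff (G.neighbors u) (G.neighbors v) ∨
        (x ∈ G.neighbors u ∩ G.neighbors v ∧ ¬ (G.black.Adj u x ∧ G.black.Adj v x)))) :
    G.Coarsens G' f := by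
  have huv : f v = f u := by grind
  have main : ∀ x y, x = u ∨ x = v → y ≠ u → y ≠ v →
      (G'.black.Adj (f x) (f y) → G.black.Adj x y) ∧ (G.black.Adj x y ∨ G.red.Adj x y →
        G'.black.Adj (f x) (f y) ∨ G'.red.Adj (f x) (f y)) := by
    intro x y hx hyu hyv
    have hfx : f x = f u := by grind
    have h2 := h' y hyu hyv
    rw [hfx, h2.1, h2.2, Set.mem_symmDiff]
    simp only [neighbors, Set.mem_inter_iff, Set.mem_ofPred_eq]
    clear h h' hf h2 hfx huv
    rcases hx with rfl | rfl <;> grind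
  have both : ∀ x y, f x ≠ f y →
      (G'.black.Adj (f x) (f y) → G.black.Adj x y) ∧ (G.black.Adj x y ∨ G.red.Adj x y →
        G'.black.Adj (f x) (f y) ∨ G'.red.Adj (f x) (f y)) := by
    intro x y hxy
    by_cases hx : x = u ∨ x = v
    · exact main x y hx (by grind) (by grind)
    by_cases hy : y = u ∨ y = v
    · have := main y x hy (by grind) (by grind)
      rwa [G'.black.adj_comm, G.black.adj_comm, G'.red.adj_comm, G.red.adj_comm]
    · have := h x y (by grind) (by grind) (by grind) (by grind)
      rw [this.1, this.2]
      exact ⟨id, id⟩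
  exact ⟨fun {x y} hxy => (both x y hxy).1, fun {x y} hxy => (both x y hxy).2⟩

/-! ### Transferring and constructing sequences -/

theorem HasDSequence.isDTrigraph {d : ℕ} {G : Trigraph V} (h : HasDSequence d G) :
    G.IsDTrigraph d := by
  cases h <;> assumption

theorem isDTrigraph_of_subsingleton [Subsingleton V] (T : Trigraph V) (d : ℕ) :
    T.IsDTrigraph d := by
  intro v
  have : {x | T.red.Adj v x} = ∅ :=
    Set.eq_empty_of_forall_notMem fun x hx => hx.ne (Subsingleton.elim _ _)
  simp [redDegree, this]

/-- The sequence of `G` is replayed on `T`, skipping contractions whose two vertices are not both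
hit by `i`. Red degrees stay bounded because red edges of `T` map injectively to red edges of `G`.
-/
theorem HasDSequence.of_coarsens {d : ℕ} {G : Trigraph V} (hG : HasDSequence d G) {U : Type u}
    [Nonempty U] {T : Trigraph U} {i : U → V} (hi : Function.Injective i) (h : T.Coarsens G i) :
    HasDSequence d T := by
  induction hG generalizing U with
  | single G hV hd =>
    have := (Nat.card_eq_one_iff_unique.1 hV).1
    have := hi.subsingleton
    exact .single T (Nat.card_eq_one_iff_unique.2 ⟨this, ‹_›⟩) (T.isDTrigraph_of_subsingleton d)
  | contract G G' hd hc hs ih =>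
    obtain ⟨u, v, f, huv, hf, hf', h1, h2⟩ := hc
    have hfi := (coarsens_of_contraction hf' h1 h2).comp h
    by_cases hinj : Function.Injective (f ∘ i)
    · exact ih hinj hfi
    · rw [Function.not_injective_iff] at hinj
      obtain ⟨a, b, hab, hne⟩ := hinj
      -- `a` and `b` are the preimages of the merged pair, so corestricting `f ∘ i` to its range is
      -- a contraction of `T`.
      have hsurj := Set.rangeFactorization_surjective (f := f ∘ i)
      have hfib : ∀ x y, Set.rangeFactorization (f ∘ i) x = Set.rangeFactorization (f ∘ i) y ↔
          x = y ∨ (x = a ∧ y = b) ∨ (x = b ∧ y = a) := by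
        intro x y
        rw [Subtype.ext_iff]
        simp only [Set.rangeFactorization_coe, Function.comp_apply, hf'] at hab ⊢
        have := @hi
        unfold Function.Injective at this
        grind
      refine .contract T _ (h.isDTrigraph hi hd) (T.isContraction_map hne hsurj hfib) ?_
      exact ih Subtype.val_injective (Coarsens.of_comp hsurj hfi)

open Classical in
/-- The map that merges `v` into `u`. -/
noncomputable def merge {u v : V} (h : u ≠ v) (x : V) : {x : V // x ≠ v} :=
  if hx : x = v then ⟨u, h⟩ else ⟨x, hx⟩

theorem merge_self {u v : V} (h : u ≠ v) : merge h v = ⟨u, h⟩ := by simp [merge]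

theorem merge_of_ne {u v : V} (h : u ≠ v) {x : V} (hx : x ≠ v) : merge h x = ⟨x, hx⟩ := by
  simp [merge, hx]

theorem merge_surjective {u v : V} (h : u ≠ v) : Function.Surjective (merge h) :=
  fun x => ⟨x.1, merge_of_ne h x.2⟩

theorem merge_eq_iff {u v : V} (h : u ≠ v) (x y : V) :
    merge h x = merge h y ↔ x = y ∨ (x = u ∧ y = v) ∨ (x = v ∧ y = u) := by
  unfold merge
  split_ifs <;> grind

theorem HasDSequence.of_merge {d : ℕ} {T : Trigraph V} (hT : T.IsDTrigraph d) {u v : V}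
    (h : u ≠ v) (hs : HasDSequence d (T.map (merge h))) : HasDSequence d T :=
  .contract T _ hT (T.isContraction_map h (merge_surjective h) (merge_eq_iff h)) hs

theorem card_merge_lt [Finite V] (v : V) : Nat.card {x : V // x ≠ v} < Nat.card V :=
  Finite.card_subtype_lt (x := v) (by simp)

/-- Every class of `d`-trigraphs that is closed under merging has `d`-sequences. -/
theorem HasDSequence.of_invariant {d : ℕ} (P : ∀ {V : Type u}, Trigraph V → Prop)
    (hP : ∀ {V : Type u} [Finite V] (T : Trigraph V), P T → T.IsDTrigraph d)
    (hmap : ∀ {V : Type u} [Finite V] (T : Trigraph V) {u v : V} (h : u ≠ v), P T →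
      P (T.map (merge h)))
    {V : Type u} [Finite V] [Nonempty V] (T : Trigraph V) (hT : P T) : HasDSequence d T := by
  induction hn : Nat.card V using Nat.strong_induction_on generalizing V with
  | _ n ih =>
    by_cases h1 : Subsingleton V
    · exact .single T (Nat.card_eq_one_iff_unique.2 ⟨h1, ‹_›⟩) (hP T hT)
    · rw [not_subsingleton_iff_nontrivial] at h1
      obtain ⟨u, v, huv⟩ := exists_pair_ne V
      have : Nonempty {x : V // x ≠ v} := ⟨⟨u, huv⟩⟩
      exact .of_merge (hP T hT) huv (ih _ (hn ▸ card_merge_lt v) _ (hmap T huv hT) rfl)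

theorem exists_hasDSequence [Finite V] [Nonempty V] (T : Trigraph V) : ∃ d, HasDSequence d T := by
  -- The number of vertices bounds every red degree, and merging only lowers it.
  refine ⟨Nat.card V, HasDSequence.of_invariant (d := Nat.card V)
    (fun {U} _ => Finite U ∧ Nat.card U ≤ Nat.card V) ?_ ?_ T ⟨‹_›, le_rfl⟩⟩
  · intro U _ T hT v
    calc T.redDegree v ≤ (Set.univ : Set U).encard := Set.encard_le_encard (Set.subset_univ _)
      _ = (Nat.card U : ℕ∞) := by rw [Set.encard_univ, ENat.card_eq_coe_natCard]
      _ ≤ Nat.card V := by exact_mod_cast hT.2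
  · intro U _ T u v h hT
    exact ⟨inferInstance, (card_merge_lt v).le.trans hT.2⟩

theorem isDTrigraph_of_red_eq_bot {T : Trigraph V} (h : T.red = ⊥) (d : ℕ) :
    T.IsDTrigraph d := by
  intro v
  simp [redDegree, h]

theorem hasDSequence_bot [Finite V] [Nonempty V] (d : ℕ) :
    HasDSequence d (ofGraph (⊥ : SimpleGraph V)) := by
  refine HasDSequence.of_invariant (fun {U} T => ∀ x y : U, ¬ T.black.Adj x y ∧ ¬ T.red.Adj x y)
    ?_ ?_ _ (by simp [ofGraph])
  · intro U _ T hT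
    exact isDTrigraph_of_red_eq_bot (by ext x y; simp [hT x y]) d
  · intro U _ T u v h hT x y
    by_contra hc
    obtain ⟨a, b, -, -, hab⟩ := map_adj_of (T := T) (a := x) (b := y) (by grind) (merge_surjective h)
    have := hT a b
    grind

theorem hasDSequence_top [Finite V] [Nonempty V] (d : ℕ) :
    HasDSequence d (ofGraph (⊤ : SimpleGraph V)) := by
  refine HasDSequence.of_invariant (fun {U} T => ∀ x y : U, x ≠ y → T.black.Adj x y)
    ?_ ?_ _ (by simp [ofGraph])
  · intro U _ T hT
    refine isDTrigraph_of_red_eq_bot ?_ d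
    ext x y
    simpa using fun h : T.red.Adj x y => T.red_not_black h (hT x y h.ne)
  · intro U _ T u v h hT x y hxy
    exact ⟨hxy, by rintro a b rfl rfl; exact hT a b fun e => hxy (congrArg _ e)⟩

/-! ### Combining sequences along a partition into modules -/

/-- The trigraph induced by the vertices in `s`. -/
def induce (T : Trigraph V) (s : Set V) : Trigraph s where
  black := T.black.induce s
  red := T.red.induce s
  disjoint := SimpleGraph.disjoint_left.2 fun _ _ hb hr => T.red_not_black hr hb

/-- If the fibres of `f` are modules without red edges to the outside, then `d`-sequences of the
quotient and of all fibres combine to a `d`-sequence. -/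
theorem HasDSequence.of_fibres {d : ℕ} {W : Type u} {H : SimpleGraph W}
    (hH : HasDSequence d (ofGraph H)) {V : Type u} [Finite V] [Nonempty V] (T : Trigraph V)
    (f : V → W) (hb : ∀ x y, f x ≠ f y → (T.black.Adj x y ↔ H.Adj (f x) (f y)))
    (hr : ∀ x y, f x ≠ f y → ¬ T.red.Adj x y)
    (hf : ∀ v, HasDSequence d (T.induce (f ⁻¹' {f v}))) : HasDSequence d T := by
  induction hn : Nat.card V using Nat.strong_induction_on generalizing V with
  | _ n ih =>
  -- If every fibre is a single vertex, all edges are black and `T` is an induced subgraph of `H`.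
  by_cases hinj : Function.Injective f
  · refine hH.of_coarsens hinj ⟨fun {x y} hxy h => (hb x y hxy).2 h, fun {x y} hxy h => ?_⟩
    exact Or.inl ((hb x y hxy).1 (h.resolve_right (hr x y hxy)))
  -- Red neighbors stay inside the fibre, so the red degree is already seen there.
  have hd : T.IsDTrigraph d := by
    intro v
    refine le_trans ?_ ((hf v).isDTrigraph ⟨v, rfl⟩)
    rw [redDegree, redDegree, ← Subtype.val_injective.encard_image]
    apply Set.encard_le_encard
    intro x hx
    have hxv : f x = f v := by
      by_contra hne
      exact hr v x (Ne.symm hne) hx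
    exact ⟨⟨x, hxv⟩, hx, rfl⟩
  rw [Function.not_injective_iff] at hinj
  obtain ⟨a, b, hab, hne⟩ := hinj
  cases hf a with
  | single _ hV _ =>
    have := (Nat.card_eq_one_iff_unique.1 hV).1
    exact absurd (congrArg Subtype.val
      (Subsingleton.elim (⟨a, rfl⟩ : f ⁻¹' {f a}) ⟨b, hab.symm⟩)) hne
  | @contract _ X _ S hS hc hs =>
  obtain ⟨⟨u, hu⟩, ⟨v, hv⟩, h, huv, hh, hh', h1, h2⟩ := hc
  have hco := coarsens_of_contraction hh' h1 h2
  have huv : u ≠ v := fun e => huv (Subtype.ext e)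
  have hfuv : f u = f v := hu.trans hv.symm
  have hfm : ∀ x, f (merge huv x).1 = f x := by
    intro x
    by_cases hx : x = v
    · rw [hx, merge_self, hfuv]
    · rw [merge_of_ne huv hx]
  have : Nonempty {x : V // x ≠ v} := ⟨⟨u, huv⟩⟩
  -- The first contraction in the sequence of the fibre of `a` is carried out in `T`; the hypotheses
  -- survive it.
  refine .of_merge hd huv (ih _ (hn ▸ card_merge_lt v) _ (f ∘ Subtype.val) ?_ ?_ ?_ rfl)
  · intro x y hxy
    constructor
    · intro hxy'
      exact (hb x y hxy).1 (hxy'.2 x y (merge_of_ne huv x.2) (merge_of_ne huv y.2))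
    · refine fun hxy' => ⟨fun e => hxy (by rw [e]), ?_⟩
      rintro x y rfl rfl
      simp only [Function.comp_apply, hfm] at hxy hxy'
      exact (hb x y hxy).2 hxy'
  -- A red edge between fibres would need an edge `p q` and a pair `p' q'` that is not black, but
  -- both pairs have the same images in `H`.
  · rintro x y hxy ⟨-, ⟨p, q, rfl, rfl, hpq⟩, p', q', hp', hq', hpq'⟩
    have e1 := hfm p'
    have e2 := hfm q'
    rw [hp', hfm] at e1
    rw [hq', hfm] at e2
    simp only [Function.comp_apply, hfm] at hxy
    have h3 := (hb p q hxy).1 (hpq.resolve_right (hr p q hxy))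
    rw [e1, e2] at h3 hxy
    exact hpq' ((hb p' q' hxy).2 h3)
  · intro w
    have : Nonempty ↑(f ∘ Subtype.val ⁻¹' {(f ∘ Subtype.val) w} : Set {x : V // x ≠ v}) :=
      ⟨⟨w, rfl⟩⟩
    by_cases hw : f w.1 = f a
    · have hmem : ∀ x : (f ∘ Subtype.val ⁻¹' {(f ∘ Subtype.val) w} : Set {x : V // x ≠ v}),
          x.1.1 ∈ f ⁻¹' {f a} := fun x => x.2.trans hw
      -- The merged fibre continues with the rest of its sequence; `h` is injective on it because it
      -- identifies only `u` with `v`, and `v` is gone.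
      refine hs.of_coarsens (i := fun x => h ⟨x.1.1, hmem x⟩) ?_ ⟨?_, ?_⟩
      · intro x y hxy
        have hx := x.1.2
        have hy := y.1.2
        have := (hh' _ _).1 hxy
        simp only [Subtype.ext_iff] at this
        refine Subtype.ext (Subtype.ext ?_)
        tauto
      all_goals
        rintro x y hxy hadj
        have hhm : ∀ (x : (f ∘ Subtype.val ⁻¹' {(f ∘ Subtype.val) w} : Set {x : V // x ≠ v}))
            (p : V) (hp : merge huv p = x.1), ∃ hp' : p ∈ f ⁻¹' {f a},
              h ⟨p, hp'⟩ = h ⟨x.1.1, hmem x⟩ := by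
          intro x p hp
          have hp' : f p = f a := by rw [← hfm, hp, show f x.1.1 = f a from hmem x]
          refine ⟨hp', (hh' _ _).2 ?_⟩
          have := (merge_eq_iff huv p x.1.1).1 (hp.trans (merge_of_ne huv x.1.2).symm)
          simpa only [Subtype.ext_iff] using this
      · refine ⟨fun e => hxy (by rw [Subtype.ext e]), fun p q hp hq => ?_⟩
        obtain ⟨hp', ep⟩ := hhm x p hp
        obtain ⟨hq', eq⟩ := hhm y q hq
        rw [← ep, ← eq] at hxy hadj
        exact hco.black hxy hadj
      · obtain ⟨p, q, hp, hq, hpq⟩ := map_adj_of hadj (merge_surjective huv)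
        obtain ⟨hp', ep⟩ := hhm x p hp
        obtain ⟨hq', eq⟩ := hhm y q hq
        rw [← ep, ← eq] at hxy ⊢
        exact hco.adj hxy hpq
    -- Any other fibre is untouched by the merge and keeps its sequence.
    · refine (hf w.1).of_coarsens (i := fun x => ⟨x.1.1, x.2⟩) ?_ ⟨?_, ?_⟩
      · intro x y hxy
        simp only [Subtype.mk.injEq] at hxy
        exact Subtype.ext (Subtype.ext hxy)
      all_goals
        intro x y hxy hadj
        have hhm : ∀ (x : (f ∘ Subtype.val ⁻¹' {(f ∘ Subtype.val) w} : Set {x : V // x ≠ v}))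
            (p : V) (hp : merge huv p = x.1), p = x.1.1 := by
          intro x p hp
          have hx : f x.1.1 = f w.1 := x.2
          have := (merge_eq_iff huv p x.1.1).1 (hp.trans (merge_of_ne huv x.1.2).symm)
          have hu' : f u = f a := hu
          have hv' : f v = f a := hv
          grind
      · refine ⟨fun e => hxy (by rw [Subtype.ext e]), fun p q hp hq => ?_⟩
        rw [hhm x p hp, hhm y q hq]
        exact hadj
      · obtain ⟨p, q, hp, hq, hpq⟩ := map_adj_of hadj (merge_surjective huv)
        rw [hhm x p hp, hhm y q hq] at hpq
        exact hpq

end Trigraph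

end TwinWidth

namespace TwinWidth

variable {V W : Type u} {G : SimpleGraph V}

open Trigraph

/-! ### Consequences for graphs -/

theorem hasDSequence_of_embedding {d : ℕ} [Nonempty W] {H : SimpleGraph W}
    (hG : HasDSequence d (ofGraph G)) (e : H ↪g G) : HasDSequence d (ofGraph H) :=
  hG.of_coarsens e.injective
    ⟨fun _ h => e.map_adj_iff.1 h, fun _ h => h.imp e.map_adj_iff.2 False.elim⟩

theorem hasDSequence_of_modules {d : ℕ} [Finite V] [Nonempty V] {H : SimpleGraph W}
    (hH : HasDSequence d (ofGraph H)) (f : V → W)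
    (hf : ∀ x y, f x ≠ f y → (G.Adj x y ↔ H.Adj (f x) (f y)))
    (hs : ∀ v, HasDSequence d (ofGraph (G.induce (f ⁻¹' {f v})))) :
    HasDSequence d (ofGraph G) := by
  refine hH.of_fibres _ f hf (fun _ _ _ h => h) fun v => ?_
  have : Nonempty (f ⁻¹' {f v}) := ⟨⟨v, rfl⟩⟩
  exact (hs v).of_coarsens (i := id) Function.injective_id ⟨fun _ h => h, fun _ h => h⟩

theorem hasDSequence_tww [Finite V] [Nonempty V] (G : SimpleGraph V) :
    HasDSequence (tww G) (ofGraph G) :=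
  Nat.sInf_mem (s := {d | HasDSequence d (ofGraph G)}) (exists_hasDSequence _)

theorem tww_le {d : ℕ} (h : HasDSequence d (ofGraph G)) : tww G ≤ d :=
  Nat.sInf_le h

theorem Trigraph.HasDSequence.mono {d e : ℕ} (hde : d ≤ e) {T : Trigraph V}
    (h : HasDSequence d T) : HasDSequence e T := by
  induction h with
  | single T hV hd => exact .single T hV fun v => (hd v).trans (by exact_mod_cast hde)
  | contract T T' hd hc _ ih =>
    exact .contract T T' (fun v => (hd v).trans (by exact_mod_cast hde)) hc ih

/-! ### Maximal modules -/

theorem exists_adj_of_connected (hG : G.Connected) {A : Set V} (hA : A.Nonempty)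
    (hA' : Aᶜ.Nonempty) : ∃ x ∈ A, ∃ y ∉ A, G.Adj x y := by
  obtain ⟨x, hx⟩ := hA
  obtain ⟨y, hy⟩ := hA'
  obtain ⟨p⟩ := hG.preconnected x y
  obtain ⟨e, -, h1, h2⟩ := p.exists_boundary_dart A hx hy
  exact ⟨_, h1, _, h2, e.adj⟩

theorem IsModule.adj_iff {M N : Set V} (hM : IsModule G M) (hN : IsModule G N)
    (hd : Disjoint M N) {x x' y y' : V} (hx : x ∈ M) (hx' : x' ∈ M) (hy : y ∈ N) (hy' : y' ∈ N) :
    G.Adj x y ↔ G.Adj x' y' := by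
  rw [hM.2 x hx x' hx' y (hd.notMem_of_mem_right hy), G.adj_comm, G.adj_comm x',
    hN.2 y hy y' hy' x' (hd.notMem_of_mem_left hx')]

theorem IsModule.union {M N : Set V} (hM : IsModule G M) (hN : IsModule G N)
    (h : (M ∩ N).Nonempty) : IsModule G (M ∪ N) := by
  obtain ⟨i, hiM, hiN⟩ := h
  have key : ∀ x ∈ M ∪ N, ∀ z ∉ M ∪ N, (G.Adj x z ↔ G.Adj i z) := by
    rintro x (hx | hx) z hz
    · exact hM.2 x hx i hiM z fun h => hz (Or.inl h)
    · exact hN.2 x hx i hiN z fun h => hz (Or.inr h)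
  exact ⟨⟨i, Or.inl hiM⟩, fun x hx y hy z hz => (key x hx z hz).trans (key y hy z hz).symm⟩

/-- If the union were everything, the complement of `N` would lie in `M`, and some `b` outside `M`
would lie in `N`. The module conditions then give all pairs across the cut between `N` and its
complement the same adjacency as `i b`, so `G` or its complement would have no edge across the cut.
-/
theorem IsModule.union_ne_univ (hG : G.Connected) (hGc : Gᶜ.Connected) {M N : Set V}
    (hM : IsModule G M) (hN : IsModule G N) (h : (M ∩ N).Nonempty) (hMu : M ≠ Set.univ)
    (hNu : N ≠ Set.univ) : M ∪ N ≠ Set.univ := by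
  intro hu
  obtain ⟨i, hiM, hiN⟩ := h
  obtain ⟨b, hb⟩ := (Set.ne_univ_iff_exists_notMem M).1 hMu
  have hbN : b ∈ N := ((Set.eq_univ_iff_forall.1 hu) b).resolve_left hb
  have hNM : ∀ a ∉ N, a ∈ M := fun a ha => ((Set.eq_univ_iff_forall.1 hu) a).resolve_right ha
  have key : ∀ a ∉ N, ∀ n ∈ N, (G.Adj n a ↔ G.Adj i b) := fun a ha n hn => by
    rw [hN.2 n hn b hbN a ha, G.adj_comm, hM.2 a (hNM a ha) i hiM b hb]
  have hNc : Nᶜ.Nonempty := Set.nonempty_compl.2 hNu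
  obtain ⟨x, hx, y, hy, hxy⟩ := exists_adj_of_connected hG ⟨i, hiN⟩ hNc
  obtain ⟨x', hx', y', hy', hxy'⟩ := exists_adj_of_connected hGc ⟨i, hiN⟩ hNc
  exact ((SimpleGraph.compl_adj _ _ _).1 hxy').2
    ((key y' hy' x' hx').2 ((key y hy x hx).1 hxy))

/-- Covers the one-vertex graph, the only one whose full vertex set is a maximal module. -/
theorem eq_of_encard_univ_eq_one {s : Set V} (hs : s.Nonempty) (h : s.encard = 1)
    (hu : s = Set.univ) : ∀ N : Set V, N.Nonempty → N = s := by
  obtain ⟨a, rfl⟩ := Set.encard_eq_one.1 h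
  rintro N ⟨b, hb⟩
  have : ∀ x, x = a := fun x => by
    have : x ∈ ({a} : Set V) := hu ▸ Set.mem_univ x
    exact this
  ext x
  rw [this x]
  exact ⟨fun _ => rfl, fun _ => this b ▸ hb⟩

/-- Otherwise the union of the two would be a nontrivial module strictly containing `M`. -/
theorem IsMaximalModule.subset (hG : G.Connected) (hGc : Gᶜ.Connected) {M N : Set V}
    (hM : IsMaximalModule G M) (hN : IsMaximalModule G N) (h : (M ∩ N).Nonempty) : N ⊆ M := by
  by_cases hMu : M = Set.univ
  · exact hMu ▸ Set.subset_univ N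
  by_cases hNu : N = Set.univ
  · exact (eq_of_encard_univ_eq_one hN.1.1 (hN.2.1 hNu) hNu M hM.1.1).ge
  by_contra hNM
  have hss : M ⊂ M ∪ N :=
    ⟨Set.subset_union_left, fun hs => hNM (Set.subset_union_right.trans hs)⟩
  refine hM.2.2 _ (hM.1.union hN.1 h) ?_ hss
  rintro (hu | h1)
  · exact hM.1.union_ne_univ hG hGc hN.1 h hMu hNu hu
  · obtain ⟨a, ha⟩ := Set.encard_eq_one.1 h1
    rw [ha, Set.ssubset_singleton_iff] at hss
    exact hM.1.1.ne_empty hss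

theorem IsMaximalModule.eq (hG : G.Connected) (hGc : Gᶜ.Connected) {M N : Set V}
    (hM : IsMaximalModule G M) (hN : IsMaximalModule G N) {x : V} (hxM : x ∈ M) (hxN : x ∈ N) :
    M = N :=
  (hN.subset hG hGc hM ⟨x, hxN, hxM⟩).antisymm (hM.subset hG hGc hN ⟨x, hxM, hxN⟩)

theorem exists_isMaximalModule [Finite V] (G : SimpleGraph V) (x : V) :
    ∃ M, IsMaximalModule G M ∧ x ∈ M := by
  have hsing : IsModule G {x} := by
    refine ⟨⟨x, rfl⟩, ?_⟩
    rintro _ rfl _ rfl z -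
    rfl
  by_cases hx : ({x} : Set V) = Set.univ
  · refine ⟨{x}, ⟨hsing, fun _ => Set.encard_singleton x, fun N _ _ hN => ?_⟩, rfl⟩
    exact hN.2 (hx ▸ Set.subset_univ N)
  · obtain ⟨M, hM⟩ := (Set.toFinite {M : Set V | IsModule G M ∧ M ≠ Set.univ ∧ x ∈ M}).exists_maximal
      ⟨{x}, hsing, hx, rfl⟩
    obtain ⟨hM1, hMu, hxM⟩ := hM.prop
    refine ⟨M, ⟨hM1, fun h => absurd h hMu, fun N hN hNt hMN => ?_⟩, hxM⟩
    exact hMN.2 (hM.le_of_ge ⟨hN, fun h => hNt (Or.inl h), hMN.1 hxM⟩ hMN.1)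

theorem quotientGraph_adj_iff (hG : G.Connected) (hGc : Gᶜ.Connected) {M N : pMax G} (hMN : M ≠ N)
    {x y : V} (hx : x ∈ M.1) (hy : y ∈ N.1) : (quotientGraph G).Adj M N ↔ G.Adj x y := by
  have hd : Disjoint M.1 N.1 :=
    Set.disjoint_left.2 fun z hzM hzN => hMN (Subtype.ext (M.2.eq hG hGc N.2 hzM hzN))
  exact ⟨fun h => h.2 x hx y hy,
    fun h => ⟨hMN, fun x' hx' y' hy' => (M.2.1.adj_iff N.2.1 hd hx hx' hy hy').1 h⟩⟩

theorem nonempty_quotientGraph_embedding (hG : G.Connected) (hGc : Gᶜ.Connected) :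
    Nonempty (quotientGraph G ↪g G) := by
  choose r hr using fun M : pMax G => M.2.1.1
  have hinj : Function.Injective r := fun M N h =>
    Subtype.ext (M.2.eq hG hGc N.2 (hr M) (h ▸ hr N))
  refine ⟨⟨⟨r, hinj⟩, fun {M N} => ?_⟩⟩
  by_cases hMN : M = N
  · simp [hMN]
  · exact (quotientGraph_adj_iff hG hGc hMN (hr M) (hr N)).symm

/-! ### The prime graphs -/

theorem MemPrime.embedding {P : Σ W : Type u, SimpleGraph W} (h : MemPrime G P) [hV : Finite V]
    [hV' : Nonempty V] : Nonempty P.1 ∧ Nonempty (P.2 ↪g G) := by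
  revert hV hV'
  induction h with
  | component hG C h ih =>
    intro _ _
    have := C.nonempty_supp.to_subtype
    obtain ⟨hP, ⟨e⟩⟩ := ih
    exact ⟨hP, ⟨e.trans (SimpleGraph.Embedding.induce C.supp)⟩⟩
  | @coComponent V G H hG C h ih =>
    intro _ _
    have := C.nonempty_supp.to_subtype
    obtain ⟨hP, ⟨e⟩⟩ := ih
    -- Complementing both sides turns an induced subgraph of the complement into one of `G`.
    have e' := (SimpleGraph.Embedding.induce (G := Gᶜ) C.supp).complEquiv
    rw [compl_compl] at e'
    exact ⟨hP, ⟨e.trans e'⟩⟩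
  | @quotient V G hG hGc =>
    rintro _ ⟨x⟩
    obtain ⟨M, hM, -⟩ := exists_isMaximalModule G x
    exact ⟨⟨⟨M, hM⟩⟩, nonempty_quotientGraph_embedding hG hGc⟩
  | maximalModule hG hGc M hM hMt h ih =>
    intro _ _
    have := hM.1.1.to_subtype
    obtain ⟨hP, ⟨e⟩⟩ := ih
    exact ⟨hP, ⟨e.trans (SimpleGraph.Embedding.induce M)⟩⟩

theorem card_component_lt [Finite V] [Nonempty V] (hG : ¬ G.Connected)
    (C : G.ConnectedComponent) : Nat.card C < Nat.card V := by
  have : ∃ x, x ∉ C.supp := by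
    by_contra! hc
    refine hG (SimpleGraph.connected_iff _ |>.2 ⟨fun x y => ?_, ‹_›⟩)
    exact SimpleGraph.ConnectedComponent.exact ((hc x).trans (hc y).symm)
  obtain ⟨x, hx⟩ := this
  exact Finite.card_subtype_lt hx

/-- Vertices in different components are non-adjacent. -/
theorem not_adj_of_component_ne {x y : V}
    (h : G.connectedComponentMk x ≠ G.connectedComponentMk y) : ¬ G.Adj x y :=
  fun ha => h (SimpleGraph.ConnectedComponent.connectedComponentMk_eq_of_adj ha)

/-- Both claims follow the recursion defining prime(G): the primes of each smaller piece are primes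
of `G`, so the bound `d` passes to the pieces and returns through the partition into modules. -/
theorem prime_spec [Finite V] [Nonempty V] (G : SimpleGraph V) :
    (∃ P, MemPrime G P) ∧ ∀ d, (∀ P, MemPrime G P → HasDSequence d (ofGraph P.2)) →
      HasDSequence d (ofGraph G) := by
  induction hn : Nat.card V using Nat.strong_induction_on generalizing V with
  | _ n ih =>
  subst hn
  by_cases hG : G.Connected
  · by_cases hGc : Gᶜ.Connected
    · refine ⟨⟨_, .quotient hG hGc⟩, fun d hd => ?_⟩
      choose m hm hxm using exists_isMaximalModule G
      let f : V → pMax G := fun x => ⟨m x, hm x⟩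
      refine hasDSequence_of_modules (hd _ (.quotient hG hGc)) f
        (fun x y hxy => (quotientGraph_adj_iff hG hGc hxy (hxm x) (hxm y)).symm) fun v => ?_
      have hfib : f ⁻¹' {f v} = m v := by
        ext x
        refine ⟨fun h => ?_, fun h => Subtype.ext ((hm x).eq hG hGc (hm v) (hxm x) h)⟩
        have h : m x = m v := congrArg Subtype.val h
        exact h ▸ hxm x
      rw [hfib]
      have : Nonempty (m v) := ⟨⟨v, hxm v⟩⟩
      -- The recursion ignores trivial maximal modules; these are single vertices.
      by_cases ht : IsTrivial (m v)
      · have h1 : (m v).encard = 1 := ht.elim (hm v).2.1 id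
        obtain ⟨a, ha⟩ := Set.encard_eq_one.1 h1
        rw [ha]
        exact .single _ (by simp) (isDTrigraph_of_subsingleton _ d)
      · obtain ⟨x, hx⟩ := (Set.ne_univ_iff_exists_notMem (m v)).1 fun h => ht (Or.inl h)
        exact (ih _ (Finite.card_subtype_lt hx) (G.induce (m v)) rfl).2 d fun P hP =>
          hd P (.maximalModule hG hGc _ (hm v) ht hP)
    · have hC : ∀ C : Gᶜ.ConnectedComponent, Nonempty C := fun C => C.nonempty_supp.to_subtype
      have hC' := fun C : Gᶜ.ConnectedComponent =>
        ih _ (card_component_lt hGc C) (C.toSimpleGraph)ᶜ rfl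
      constructor
      · obtain ⟨P, hP⟩ := (hC' (Gᶜ.connectedComponentMk (Classical.arbitrary V))).1
        exact ⟨P, .coComponent hGc _ hP⟩
      · intro d hd
        -- Vertices in different components of the complement are adjacent in `G`, so the quotient
        -- is complete.
        refine hasDSequence_of_modules (hasDSequence_top d) Gᶜ.connectedComponentMk ?_ ?_
        · intro x y hxy
          have := not_adj_of_component_ne hxy
          have hne : x ≠ y := fun e => hxy (congrArg _ e)
          simp only [SimpleGraph.compl_adj, not_and, not_not] at this
          simp [hxy, this hne]
        · intro v
          have : Nonempty (Gᶜ.connectedComponentMk ⁻¹' {Gᶜ.connectedComponentMk v}) :=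
            ⟨⟨v, rfl⟩⟩
          refine hasDSequence_of_embedding ((hC' (Gᶜ.connectedComponentMk v)).2 d fun P hP =>
            hd P (.coComponent hGc _ hP)) ⟨⟨fun x => ⟨x.1, x.2⟩, fun x y h => ?_⟩, ?_⟩
          · exact Subtype.ext (congrArg (fun z => z.1) h)
          · intro x y
            have : x = y ↔ x.1 = y.1 := Subtype.ext_iff
            have := fun h : G.Adj x.1 y.1 => h.ne
            simp [SimpleGraph.ConnectedComponent.toSimpleGraph]
            tauto
  · have hC : ∀ C : G.ConnectedComponent, Nonempty C := fun C => C.nonempty_supp.to_subtype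
    have hC' := fun C : G.ConnectedComponent => ih _ (card_component_lt hG C) C.toSimpleGraph rfl
    constructor
    · obtain ⟨P, hP⟩ := (hC' (G.connectedComponentMk (Classical.arbitrary V))).1
      exact ⟨P, .component hG _ hP⟩
    · intro d hd
      refine hasDSequence_of_modules (hasDSequence_bot d) G.connectedComponentMk
        (fun x y hxy => by simp [not_adj_of_component_ne hxy]) ?_
      intro v
      exact (hC' (G.connectedComponentMk v)).2 d fun P hP => hd P (.component hG _ hP)

end TwinWidth

/-! ### The theorem -/

theorem theorem2 {V : Type*} [Finite V] [Nonempty V] (G : SimpleGraph V) :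
    IsGreatest {d : ℕ | ∃ P ∈ TwinWidth.prime G, TwinWidth.tww P.2 = d} (TwinWidth.tww G) := by
  have hfin : ∀ P ∈ TwinWidth.prime G, Nonempty P.1 ∧ Finite P.1 ∧ Nonempty (P.2 ↪g G) := by
    intro P hP
    obtain ⟨hne, ⟨e⟩⟩ := TwinWidth.MemPrime.embedding hP
    exact ⟨hne, Finite.of_injective e e.injective, ⟨e⟩⟩
  have hle : ∀ P ∈ TwinWidth.prime G, TwinWidth.tww P.2 ≤ TwinWidth.tww G := by
    intro P hP
    obtain ⟨hne, -, ⟨e⟩⟩ := hfin P hP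
    exact TwinWidth.tww_le (TwinWidth.hasDSequence_of_embedding (TwinWidth.hasDSequence_tww G) e)
  refine ⟨?_, fun d ⟨P, hP, hd⟩ => hd ▸ hle P hP⟩
  set D : Set ℕ := {d : ℕ | ∃ P ∈ TwinWidth.prime G, TwinWidth.tww P.2 = d} with hD
  have hbdd : BddAbove D := ⟨TwinWidth.tww G, fun d ⟨P, hP, hd⟩ => hd ▸ hle P hP⟩
  obtain ⟨⟨P₀, hP₀⟩, hspec⟩ := TwinWidth.prime_spec G
  -- Non-emptiness of prime(G) matters: the supremum of the empty set would be the default 0 and not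
  -- attained.
  have hmem : sSup D ∈ D := Nat.sSup_mem ⟨_, P₀, hP₀, rfl⟩ hbdd
  have hG : TwinWidth.tww G ≤ sSup D := by
    refine TwinWidth.tww_le (hspec _ fun P hP => ?_)
    obtain ⟨hne, hf, -⟩ := hfin P hP
    exact (TwinWidth.hasDSequence_tww P.2).mono (le_csSup hbdd ⟨P, hP, rfl⟩)
  obtain ⟨P, hP, hPd⟩ := hmem
  exact ⟨P, hP, (hle P hP).antisymm (hPd ▸ hG)⟩
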